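/- Let $\mathcal P_d$ be a probability measure on $\mathbb R^d$ (data) and $\mathcal P_z$ a probability measure on $\mathbb R^m$ (noise). Let $K\subseteq\mathbb R$ be a convex set with $1-y\in K$ for all $y\in K$ (for instance $K=[0,1]$, when discriminator outputs are probabilities), and let $f$ be concave, nondecreasing and $L_f$-Lipschitz on $K$. Let $D_\theta:\mathbb R^d\to K$, $\theta\in\mathbb R^t$, be a family of discriminators, one of which is constantly $1/2$, and for each $i\ge 1$ let $G^{(i)}_\gamma:\mathbb R^m\to\mathbb R^d$, $\gamma\in\mathbb R^g$, be the family of possible $i$-th generators (the families for different $i$ may coincide). Assume that $D_\theta(x)$ and $G^{(i)}_\gamma(z)$ are $L$-Lipschitz in the input for each fixed parameter and in the parameter for each fixed input, with respect to Euclidean norms. Put $$\phi_i(\gamma;\theta)=\mathbb E_{x\sim\mathcal P_d} f(D_\theta(x))+\mathbb E_{z\sim\mathcal P_z} f(1-D_\theta(G^{(i)}_\gamma(z))),\qquad \Phi(\gamma_1,\dots,\gamma_I;\theta)=\sum_{i=1}^I\phi_i(\gamma_i;\theta),$$ and assume that these expectations are finite (this is automatic if $K$ is bounded). For $u\in\mathbb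 R^t$ let $$h_i(u)=\inf_{\gamma\in\mathbb R^g}\ \sup_{\theta\in\mathbb R^t}\{\theta^{T}u+\phi_i(\gamma;\theta)\},\qquad \breve{\mathsf{cl}}\,h_i(u)=\inf\Big\{\sum_{j=1}^{t+2}a^jh_i(u^j):\ u=\sum_{j=1}^{t+2} a^ju^j,\ \sum_{j=1}^{t+2} a^j=1,\ a^j\ge0\Big\},$$ $\Delta_\gamma^i=\sup_u\{h_i(u)-\breve{\mathsf{cl}}\,h_i(u)\}$ (ignoring points where both terms are $+\infty$) and $\Delta_\gamma^{\mathsf{worst}}=\max_{1\le i\le I}\Delta_\gamma^i$. Assume that, for every $i$, $\mathsf{dom}\,h_i=\{h_i<+\infty\}$ is compact and convex and $h_i$ is continuous on it. Assume finally that for every $i$ and every $\xi>0$ there are $\gamma\in\mathbb R^g$ and a joint law of $x\sim\mathcal P_d$ and $z\sim\mathcal P_z$ (independent or not) with $\mathbb E\|G^{(i)}_\gamma(z)-x\|_2\le\xi$. Then $\Delta_\gamma^{\mathsf{worst}}<\infty$ for every $I$. Moreover, for every $\epsilon>0$ and every integer $I\ge1$ with $I\ge\frac{t+1}{\epsilon}\Delta_\gamma^{\mathsf{worst}}$,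 there are parameters $\gamma_1^*,\dots,\gamma_I^*\in\mathbb R^g$ and $\theta^*\in\mathbb R^t$ such that, with $V=2I f(1/2)$, $$\Phi(\gamma_1,\dots,\gamma_I;\theta^*)\ge V-\epsilon\quad\text{for all }\gamma_1,\dots,\gamma_I\in\mathbb R^g,\qquad \Phi(\gamma_1^*,\dots,\gamma_I^*;\theta)\le V+\epsilon\quad\text{for all }\theta\in\mathbb R^t,$$ and the same two inequalities hold for the averaged payoff $\frac1I\Phi$ with $V=2f(1/2)$. -/

import Mathlib

open MeasureTheory
open scoped NNReal ENNReal

noncomputable section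

namespace StackelbergGAN

/-- `ℝⁿ` with the Euclidean norm. -/
abbrev E (n : ℕ) : Type := EuclideanSpace ℝ (Fin n)

/-- Convex conjugate `F*(u) = sup_v (⟨v, u⟩ - F v)`, with values in `[-∞, ∞]`. -/
def conjugate {n : ℕ} (F : E n → EReal) (u : E n) : EReal :=
  ⨆ v : E n, ((inner ℝ v u : ℝ) : EReal) - F v

/-- Effective domain of an extended-real-valued function. -/
def effDom {n : ℕ} (F : E n → EReal) : Set (E n) := {u | F u < ⊤}

/-- Convex closure: infimum of `∑ aʲ F(uʲ)` over all representations of `u` as a convex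
combination of `n + 2` points. (In `EReal`, `0 * ⊤ = 0`, so points of weight zero do not count.) -/
def convexClosure {n : ℕ} (F : E n → EReal) (u : E n) : EReal :=
  ⨅ (a : Fin (n + 2) → ℝ) (v : Fin (n + 2) → E n)
    (_ : (∀ j, 0 ≤ a j) ∧ ∑ j, a j = 1 ∧ ∑ j, a j • v j = u),
    ∑ j, (a j : EReal) * F (v j)

/-- Payoff of one generator against the discriminator:
`φ(γ; θ) = E_{x ∼ Pd} f(D_θ(x)) + E_{z ∼ Pz} f(1 - D_θ(G_γ(z)))`. -/
def phi {d m g t : ℕ} (f : ℝ → ℝ) (D : E t → E d → ℝ) (Pd : Measure (E d)) (Pz : Measure (E m))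
    (G : E g → E m → E d) (γ : E g) (θ : E t) : ℝ :=
  (∫ x, f (D θ x) ∂Pd) + (∫ z, f (1 - D θ (G γ z)) ∂Pz)

/-- Stackelberg GAN payoff `Φ(γ₁, …, γ_I; θ) = ∑ᵢ φ(γᵢ; θ)`; the `i`-th generator uses the
architecture `G i`. -/
def Phi {d m g t : ℕ} (f : ℝ → ℝ) (D : E t → E d → ℝ) (Pd : Measure (E d)) (Pz : Measure (E m))
    (G : ℕ → E g → E m → E d) (I : ℕ) (γ : Fin I → E g) (θ : E t) : ℝ :=
  ∑ i : Fin I, phi f D Pd Pz (G i) (γ i) θ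

/-- `h(u) = inf_γ (-φ(γ; ·))*(u)`. -/
def hFun {d m g t : ℕ} (f : ℝ → ℝ) (D : E t → E d → ℝ) (Pd : Measure (E d)) (Pz : Measure (E m))
    (G : E g → E m → E d) (u : E t) : EReal :=
  ⨅ γ : E g, conjugate (fun θ : E t => ((-phi f D Pd Pz G γ θ : ℝ) : EReal)) u

/-- `sup_u (F u - convexClosure F u)`. (In `EReal`, `⊤ - ⊤ = ⊥`, so points where both are
infinite do not count.) -/
def convexityGap {n : ℕ} (F : E n → EReal) : EReal :=
  ⨆ u : E n, F u - convexClosure F u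

/-- `Δ_γ^worst`: the largest gap among the first `I` generators. -/
def deltaWorst {d m g t : ℕ} (f : ℝ → ℝ) (D : E t → E d → ℝ) (Pd : Measure (E d))
    (Pz : Measure (E m)) (G : ℕ → E g → E m → E d) (I : ℕ) : EReal :=
  ⨆ i : Fin I, convexityGap (hFun f D Pd Pz (G i))

/-- `(γ₀, θ₀)` is an `ε`-approximate equilibrium of value `V` for the payoff `Ψ`, which the
discriminator parameter `θ` maximizes and the generator parameters `γ` minimize. -/
def IsApproxEquilibrium {A B : Type*} (Ψ : A → B → ℝ) (V ε : ℝ) (γ₀ : A) (θ₀ : B) : Prop :=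
  (∀ γ, V - ε ≤ Ψ γ θ₀) ∧ (∀ θ, Ψ γ₀ θ ≤ V + ε)

/-- The generator architecture `G` approximates `Pd` arbitrarily well: for every `ξ > 0` some
generator satisfies `E ‖G_γ(z) - x‖₂ ≤ ξ` for some joint law `π` of `x ∼ Pd` and `z ∼ Pz`
(independent or not). -/
def ApproximatesData {d m g : ℕ} (Pd : Measure (E d)) (Pz : Measure (E m))
    (G : E g → E m → E d) : Prop :=
  ∀ ξ : ℝ, 0 < ξ → ∃ (γ : E g) (π : Measure (E d × E m)), π.fst = Pd ∧ π.snd = Pz ∧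
    ∫⁻ p, ‖G γ p.2 - p.1‖ₑ ∂π ≤ ENNReal.ofReal ξ

end StackelbergGAN

end

namespace StackelbergGAN

/-! The equilibrium is explicit. Against the constant discriminator `1/2` every generator has payoff
exactly `2 f(1/2)`, which gives the lower bound. For the upper bound, concavity on a set symmetric
about `1/2` gives `f y + f (1 - y) ≤ 2 f(1/2)`; a generator within `ξ` of the data in some coupling
exceeds this by at most `Lf * L * ξ`, for all discriminators at once (`phi_le_of_coupling`). The
same constant discriminator bounds each `h_i` below by an affine function, a bound inherited by the
convex closure. On the compact domain `h_i` is bounded above, so the gap is finite there; off the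
domain both terms are `⊤`. -/

/-- A function with an affine minorant has the same affine minorant under `convexClosure`. -/
theorem affine_le_convexClosure {n : ℕ} {F : E n → EReal} {w : E n} {c : ℝ}
    (hF : ∀ u, ((inner ℝ w u + c : ℝ) : EReal) ≤ F u) (u : E n) :
    ((inner ℝ w u + c : ℝ) : EReal) ≤ convexClosure F u := by
  refine le_iInf fun a => le_iInf fun v => le_iInf fun h => ?_
  obtain ⟨ha, hsum, hu⟩ := h
  have hreal : inner ℝ w u + c = ∑ j, a j * (inner ℝ w (v j) + c) := by
    simp only [mul_add, Finset.sum_add_distrib, ← Finset.sum_mul, hsum, one_mul, ← hu, inner_sum,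
      real_inner_smul_right]
  have hcoe : ((∑ j, a j * (inner ℝ w (v j) + c) : ℝ) : EReal)
      = ∑ j, (a j : EReal) * ((inner ℝ w (v j) + c : ℝ) : EReal) := by
    simp only [← EReal.coe_mul]
    exact map_sum (⟨⟨Real.toEReal, rfl⟩, EReal.coe_add⟩ : ℝ →+ EReal)
      (fun j => a j * (inner ℝ w (v j) + c)) Finset.univ
  rw [hreal, hcoe]
  exact Finset.sum_le_sum fun j _ =>
    mul_le_mul_of_nonneg_left (hF (v j)) (EReal.coe_nonneg.2 (ha j))

/-- Outside a convex effective domain the convex closure of a function without the value `⊥`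
is infinite. -/
theorem convexClosure_eq_top {n : ℕ} {F : E n → EReal} (hbot : ∀ u, F u ≠ ⊥)
    (hconv : Convex ℝ (effDom F)) {u : E n} (hu : F u = ⊤) : convexClosure F u = ⊤ := by
  refine top_le_iff.1 (le_iInf fun a => le_iInf fun v => le_iInf fun h => ?_)
  obtain ⟨ha, hsum, hv⟩ := h
  -- Otherwise every point of positive weight lies in the convex domain, and so does `u`.
  obtain ⟨j, hj, hjt⟩ : ∃ j, 0 < a j ∧ F (v j) = ⊤ := by
    by_contra! hne
    have hmem : ∑ j with a j ≠ 0, a j • v j ∈ effDom F := by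
      refine hconv.sum_mem (fun j _ => ha j) ?_ ?_
      · rw [Finset.sum_filter_ne_zero, hsum]
      · intro j hj
        have hj' : a j ≠ 0 := by simpa using hj
        exact lt_top_iff_ne_top.2 (hne j (lt_of_le_of_ne (ha j) hj'.symm))
    have hfilter : ∑ j with a j ≠ 0, a j • v j = u := by
      rw [← hv]
      refine Finset.sum_filter_of_ne fun j _ hj h0 => hj ?_
      rw [h0, zero_smul]
    rw [hfilter] at hmem
    exact (ne_of_lt hmem) hu
  -- Needed because `⊤ + ⊥ = ⊥` in `EReal`: one `⊥` term would swallow the `⊤`.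
  have hterm : ∀ k, (a k : EReal) * F (v k) ≠ ⊥ := by
    intro k
    rcases (ha k).eq_or_lt with h0 | hpos
    · rw [← h0]; simp
    · induction hF : F (v k) with
      | bot => exact absurd hF (hbot _)
      | coe r => rw [← EReal.coe_mul]; exact EReal.coe_ne_bot _
      | top => rw [EReal.coe_mul_top_of_pos hpos]; simp
  rw [← Finset.add_sum_erase _ _ (Finset.mem_univ j), hjt, EReal.coe_mul_top_of_pos hj]
  refine top_le_iff.2 (EReal.top_add_of_ne_bot ?_)
  refine Finset.sum_induction _ (fun x : EReal => x ≠ ⊥) ?_ (by simp) fun k _ => hterm k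
  intro x y hx hy
  simp [EReal.add_eq_bot_iff, hx, hy]

/-- The convexity gap is finite for a function with an affine minorant that is continuous on a
compact convex effective domain. -/
theorem convexityGap_lt_top {n : ℕ} {F : E n → EReal} {w : E n} {c : ℝ}
    (hF : ∀ u, ((inner ℝ w u + c : ℝ) : EReal) ≤ F u) (hcont : ContinuousOn F (effDom F))
    (hcomp : IsCompact (effDom F)) (hconv : Convex ℝ (effDom F)) : convexityGap F < ⊤ := by
  have hbot : ∀ u, F u ≠ ⊥ := fun u =>
    ne_of_gt (lt_of_lt_of_le (EReal.bot_lt_coe _) (hF u))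
  have hclosure := affine_le_convexClosure hF
  have hoff : ∀ u, u ∉ effDom F → F u - convexClosure F u = ⊥ := by
    intro u hu
    have hu' : F u = ⊤ := not_lt_top_iff.1 hu
    rw [hu', convexClosure_eq_top hbot hconv hu', EReal.sub_top]
  rcases (effDom F).eq_empty_or_nonempty with hempty | hne
  · refine lt_of_le_of_lt (iSup_le fun u => ?_) bot_lt_top
    rw [hoff u (by simp [hempty])]
  obtain ⟨x, hx, hmax⟩ := hcomp.exists_isMaxOn hne hcont
  obtain ⟨M, hM⟩ : ∃ M : ℝ, F x = M :=
    ⟨(F x).toReal, (EReal.coe_toReal (ne_of_lt hx) (hbot x)).symm⟩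
  obtain ⟨y, -, hmin⟩ := hcomp.exists_isMinOn hne
    (f := fun u => inner ℝ w u + c) (by fun_prop)
  -- The bound is the maximum of `F` minus the minimum of its affine minorant, both over the domain.
  refine lt_of_le_of_lt (iSup_le fun u => ?_) (EReal.coe_lt_top (M - (inner ℝ w y + c)))
  by_cases hu : u ∈ effDom F
  · rw [EReal.coe_sub]
    refine EReal.sub_le_sub (hM ▸ hmax hu) (le_trans ?_ (hclosure u))
    exact EReal.coe_le_coe_iff.2 (hmin hu)
  · rw [hoff u hu]; exact bot_le

section Payoff

variable {d m g t : ℕ} {Pd : Measure (E d)} {Pz : Measure (E m)} {f : ℝ → ℝ} {D : E t → E d → ℝ}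

theorem phi_eq_of_const_half [IsProbabilityMeasure Pd] [IsProbabilityMeasure Pz]
    {θ : E t} (hθ : ∀ x, D θ x = 1 / 2) (G : E g → E m → E d) (γ : E g) :
    phi f D Pd Pz G γ θ = 2 * f (1 / 2) := by
  have h : (1 : ℝ) - 1 / 2 = 1 / 2 := by norm_num
  simp only [phi, hθ, h, integral_const, probReal_univ, one_smul]
  ring

/-- A discriminator that makes the payoff constant gives an affine minorant of `hFun`. -/
theorem affine_le_hFun {G : E g → E m → E d} {θ : E t} {c : ℝ}
    (hθ : ∀ γ, phi f D Pd Pz G γ θ = c) (u : E t) :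
    ((inner ℝ θ u + c : ℝ) : EReal) ≤ hFun f D Pd Pz G u := by
  refine le_iInf fun γ => le_trans (le_of_eq ?_) (le_iSup _ θ)
  rw [← EReal.coe_sub, hθ, sub_neg_eq_add]

/-- Concavity at `1 / 2` on a set symmetric under `y ↦ 1 - y`. -/
theorem add_reflect_le_two_mul_half {K : Set ℝ} (hK : ∀ y ∈ K, 1 - y ∈ K)
    (hf : ConcaveOn ℝ K f) {y : ℝ} (hy : y ∈ K) : f y + f (1 - y) ≤ 2 * f (1 / 2) := by
  have h := hf.2 hy (hK y hy) (by norm_num : (0 : ℝ) ≤ 1 / 2) (by norm_num : (0 : ℝ) ≤ 1 / 2)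
    (by norm_num)
  have hmid : (1 / 2 : ℝ) • y + (1 / 2 : ℝ) • (1 - y) = 1 / 2 := by
    simp only [smul_eq_mul]; ring
  rw [hmid] at h
  simp only [smul_eq_mul] at h
  linarith

/-- A generator close to the data in a coupling keeps the payoff near `2 f(1/2)` uniformly in the
discriminator. -/
theorem phi_le_of_coupling [IsProbabilityMeasure Pd] {K : Set ℝ}
    (hK : ∀ y ∈ K, 1 - y ∈ K) (hf_conc : ConcaveOn ℝ K f)
    {Lf L : ℝ≥0} (hf_lip : LipschitzOnWith Lf f K) (hDK : ∀ θ x, D θ x ∈ K)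
    (hD : ∀ θ, LipschitzWith L (D θ)) {G : E g → E m → E d} {γ : E g}
    (hG : Continuous (G γ)) {π : Measure (E d × E m)} (hfst : π.fst = Pd) (hsnd : π.snd = Pz)
    {ξ : ℝ} (hξ : 0 ≤ ξ) (hπ : ∫⁻ p, ‖G γ p.2 - p.1‖ₑ ∂π ≤ ENNReal.ofReal ξ) {θ : E t}
    (hd : Integrable (fun x => f (D θ x)) Pd)
    (hz : Integrable (fun z => f (1 - D θ (G γ z))) Pz) :
    phi f D Pd Pz G γ θ ≤ 2 * f (1 / 2) + Lf * L * ξ := by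
  subst hfst hsnd
  have : IsProbabilityMeasure π := ⟨by rw [← Measure.fst_univ]; exact measure_univ⟩
  have hint : Integrable (fun p : E d × E m => G γ p.2 - p.1) π :=
    ⟨Continuous.aestronglyMeasurable (by fun_prop), hπ.trans_lt ENNReal.ofReal_lt_top⟩
  have hnorm : ∫ p, ‖G γ p.2 - p.1‖ ∂π ≤ ξ := by
    rw [integral_norm_eq_lintegral_enorm hint.1]
    exact ENNReal.toReal_le_of_le_ofReal hξ hπ
  have hd' : Integrable (fun p : E d × E m => f (D θ p.1)) π := hd.comp_measurable measurable_fst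
  have hz' : Integrable (fun p : E d × E m => f (1 - D θ (G γ p.2))) π :=
    hz.comp_measurable measurable_snd
  -- Replacing `G γ z` by `x` inside `f (1 - D θ ·)` costs the Lipschitz term; the reflection
  -- inequality at `D θ x` does the rest.
  have hpoint : ∀ p : E d × E m, f (D θ p.1) + f (1 - D θ (G γ p.2))
      ≤ 2 * f (1 / 2) + Lf * L * ‖G γ p.2 - p.1‖ := by
    intro p
    have h₁ := add_reflect_le_two_mul_half hK hf_conc (hDK θ p.1)
    have h₂ := hf_lip.dist_le_mul _ (hK _ (hDK θ (G γ p.2))) _ (hK _ (hDK θ p.1))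
    have h₃ := (hD θ).dist_le_mul (G γ p.2) p.1
    rw [dist_sub_left] at h₂
    rw [dist_eq_norm (G γ p.2)] at h₃
    have h₄ := mul_le_mul_of_nonneg_left h₃ Lf.coe_nonneg
    have h₅ := le_trans (le_abs_self _) (Real.dist_eq _ _ ▸ h₂)
    rw [← mul_assoc] at h₄
    linarith
  -- Each expectation depends on one marginal only, so any coupling may carry both.
  calc phi f D π.fst π.snd G γ θ
      = ∫ p, (f (D θ p.1) + f (1 - D θ (G γ p.2))) ∂π := by
        rw [integral_add hd' hz', phi, Measure.fst, Measure.snd,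
          integral_map measurable_fst.aemeasurable hd.1,
          integral_map measurable_snd.aemeasurable hz.1]
    _ ≤ ∫ p, (2 * f (1 / 2) + Lf * L * ‖G γ p.2 - p.1‖) ∂π :=
        integral_mono (hd'.add hz') ((integrable_const _).add (hint.norm.const_mul _)) hpoint
    _ = 2 * f (1 / 2) + Lf * L * ∫ p, ‖G γ p.2 - p.1‖ ∂π := by
        rw [integral_add (integrable_const _) (hint.norm.const_mul _), integral_const,
          integral_const_mul, probReal_univ, one_smul]
    _ ≤ 2 * f (1 / 2) + Lf * L * ξ := by gcongr

end Payoff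

/-- Scaling a payoff and its value by a factor in `[0, 1]` preserves approximate equilibria. -/
theorem IsApproxEquilibrium.const_mul {A B : Type*} {Ψ : A → B → ℝ} {V ε c : ℝ} {γ₀ : A} {θ₀ : B}
    (h : IsApproxEquilibrium Ψ V ε γ₀ θ₀) (hε : 0 ≤ ε) (hc₀ : 0 ≤ c) (hc₁ : c ≤ 1) :
    IsApproxEquilibrium (fun γ θ => c * Ψ γ θ) (c * V) ε γ₀ θ₀ := by
  have hcε : c * ε ≤ ε := mul_le_of_le_one_left hε hc₁
  refine ⟨fun γ => ?_, fun θ => ?_⟩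
  · have := mul_le_mul_of_nonneg_left (h.1 γ) hc₀
    rw [mul_sub] at this
    linarith
  · have := mul_le_mul_of_nonneg_left (h.2 θ) hc₀
    rw [mul_add] at this
    linarith

end StackelbergGAN

theorem theorem2 {d m g t : ℕ}
    -- data and noise distributions
    (Pd : Measure (StackelbergGAN.E d)) [IsProbabilityMeasure Pd]
    (Pz : Measure (StackelbergGAN.E m)) [IsProbabilityMeasure Pz]
    -- admissible discriminator outputs, e.g. `[0, 1]` (probabilities) or `ℝ` (Wasserstein)
    (K : Set ℝ) (hK : ∀ y ∈ K, 1 - y ∈ K)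
    (f : ℝ → ℝ) (hf_conc : ConcaveOn ℝ K f) (hf_mono : MonotoneOn f K)
    (Lf : ℝ≥0) (hf_lip : LipschitzOnWith Lf f K)
    -- discriminators and generator architectures, Lipschitz in inputs and in parameters
    (L : ℝ≥0)
    (D : StackelbergGAN.E t → StackelbergGAN.E d → ℝ) (hDK : ∀ θ x, D θ x ∈ K)
    (hD_input : ∀ θ, LipschitzWith L (D θ))
    (hD_param : ∀ x, LipschitzWith L (fun θ => D θ x))
    (hD_half : ∃ θ, ∀ x, D θ x = 1 / 2)
    (G : ℕ → StackelbergGAN.E g → StackelbergGAN.E m → StackelbergGAN.E d)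
    (hG_input : ∀ i γ, LipschitzWith L (G i γ))
    (hG_param : ∀ i z, LipschitzWith L (fun γ => G i γ z))
    -- the payoff is well defined (automatic if `K` is bounded)
    (h_int_d : ∀ θ, Integrable (fun x => f (D θ x)) Pd)
    (h_int_z : ∀ i γ θ, Integrable (fun z => f (1 - D θ (G i γ z))) Pz)
    -- each `h_i` is continuous on its domain, which is compact and convex
    (hh_cont : ∀ i, ContinuousOn (StackelbergGAN.hFun f D Pd Pz (G i))
      (StackelbergGAN.effDom (StackelbergGAN.hFun f D Pd Pz (G i))))
    (hh_compact : ∀ i, IsCompact (StackelbergGAN.effDom (StackelbergGAN.hFun f D Pd Pz (G i))))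
    (hh_convex : ∀ i, Convex ℝ (StackelbergGAN.effDom (StackelbergGAN.hFun f D Pd Pz (G i))))
    -- the generators approximate the data distribution
    (h_approx : ∀ i, StackelbergGAN.ApproximatesData Pd Pz (G i)) :
    (∀ I : ℕ, StackelbergGAN.deltaWorst f D Pd Pz G I < ⊤) ∧
    ∀ ε : ℝ, 0 < ε → ∀ I : ℕ, 1 ≤ I →
      ((((t : ℝ) + 1) / ε : ℝ) : EReal) * StackelbergGAN.deltaWorst f D Pd Pz G I
        ≤ ((I : ℝ) : EReal) →
      ∃ (γ₀ : Fin I → StackelbergGAN.E g) (θ₀ : StackelbergGAN.E t),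
        StackelbergGAN.IsApproxEquilibrium (StackelbergGAN.Phi f D Pd Pz G I)
          (I * (2 * f (1 / 2))) ε γ₀ θ₀ ∧
        StackelbergGAN.IsApproxEquilibrium
          (fun γ θ => (1 / (I : ℝ)) * StackelbergGAN.Phi f D Pd Pz G I γ θ)
          (2 * f (1 / 2)) ε γ₀ θ₀ := by
  obtain ⟨θh, hθh⟩ := hD_half
  have hhalf := fun i γ => StackelbergGAN.phi_eq_of_const_half (f := f) (Pd := Pd) (Pz := Pz)
    hθh (G i) γ
  refine ⟨fun I => ?_, fun ε hε I hI _ => ?_⟩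
  · rcases isEmpty_or_nonempty (Fin I) with hI | hI
    · rw [StackelbergGAN.deltaWorst, iSup_of_empty]
      exact bot_lt_top
    -- A finite supremum is attained, so finiteness of each single gap suffices.
    · obtain ⟨i, hi⟩ := exists_eq_ciSup_of_finite
        (f := fun i : Fin I => StackelbergGAN.convexityGap (StackelbergGAN.hFun f D Pd Pz (G i)))
      rw [StackelbergGAN.deltaWorst, ← hi]
      exact StackelbergGAN.convexityGap_lt_top (StackelbergGAN.affine_le_hFun (hhalf i))
        (hh_cont i) (hh_compact i) (hh_convex i)
  · have hI₁ : (1 : ℝ) ≤ I := by exact_mod_cast hI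
    have hI₀ : (0 : ℝ) < I := by linarith
    -- With `ξ = ε / C` the `I` errors `Lf * L * ξ` add up to at most `ε`; the `+ 1` keeps `C`
    -- positive when `Lf * L = 0`.
    set C : ℝ := I * (Lf * L + 1) with hC
    have hC₀ : 0 < C := by positivity
    choose γ₀ π hfst hsnd hπ using fun i => h_approx i (ε / C) (by positivity)
    have heq : StackelbergGAN.IsApproxEquilibrium (StackelbergGAN.Phi f D Pd Pz G I)
        (I * (2 * f (1 / 2))) ε (fun i : Fin I => γ₀ i) θh := by
      refine ⟨fun γ => ?_, fun θ => ?_⟩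
      · simp only [StackelbergGAN.Phi, hhalf, Finset.sum_const, Finset.card_univ, Fintype.card_fin,
          nsmul_eq_mul]
        linarith
      · have hle : StackelbergGAN.Phi f D Pd Pz G I (fun i : Fin I => γ₀ i) θ
            ≤ ∑ _i : Fin I, (2 * f (1 / 2) + Lf * L * (ε / C)) :=
          Finset.sum_le_sum fun i _ => StackelbergGAN.phi_le_of_coupling hK hf_conc hf_lip hDK
            hD_input (hG_input i (γ₀ i)).continuous (hfst i) (hsnd i) (by positivity) (hπ i)
            (h_int_d θ) (h_int_z i (γ₀ i) θ)
        simp only [Finset.sum_const, Finset.card_univ, Fintype.card_fin, nsmul_eq_mul] at hle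
        have hsmall : I * (Lf * L * (ε / C)) ≤ ε := by
          calc I * (Lf * L * (ε / C)) = (I * (Lf * L)) * (ε / C) := by ring
            _ ≤ C * (ε / C) := by rw [hC]; gcongr; linarith
            _ = ε := mul_div_cancel₀ ε hC₀.ne'
        linarith
    refine ⟨fun i => γ₀ i, θh, heq, ?_⟩
    have hscale := heq.const_mul (c := 1 / (I : ℝ)) hε.le (by positivity)
      ((div_le_one hI₀).2 hI₁)
    rwa [← mul_assoc, one_div_mul_cancel hI₀.ne', one_mul] at hscale
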